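/- **Setting.** A Borel space is a separable metrizable space whose Borel $\sigma$-algebra is standard Borel (equivalently, a topological space homeomorphic to a Borel subset of a Polish space). Let $\mathcal S,\mathcal U$ be Borel spaces. A Markov decision model $(\mathcal S,\mathcal U,\{\mathcal U(s)\},Q,r)$ consists of nonempty sets $\mathcal U(s)\subseteq\mathcal U$ $(s\in\mathcal S)$ whose graph $\mathbb K=\{(s,u): s\in\mathcal S,\ u\in\mathcal U(s)\}$ is measurable, a stochastic kernel $Q$ on $\mathcal S$ given $\mathbb K$, and a measurable function $r:\mathbb K\to\mathbb R$. A randomized policy is a sequence $\pi=(\pi_t)_{t\ge0}$ of stochastic kernels on $\mathcal U$ given the histories $h_t=(s_0,u_0,\dots,s_{t-1},u_{t-1},s_t)$ with $\pi_t(\mathcal U(s_t)\mid h_t)=1$ for every admissible history (one with $(s_k,u_k)\in\mathbb K$ for $k<t$); $\Pi$ is the set of all randomized policies, and $\mathbb E^\pi_{s}$ is the expectation for the process $(s_t,u_t)_{t\ge0}$ with $s_0=s$, $u_t\sim\pi_t(\cdot\mid h_t)$ and $s_{t+1}\sim Q(\cdot\mid s_t,u_t)$. For $\alpha\in[0,1)$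 put $$V(\pi,s)=\mathbb E^\pi_s\Big[\sum_{t=0}^\infty\alpha^t r(s_t,u_t)\Big],\qquad V^*(s)=\sup_{\pi\in\Pi}V(\pi,s).$$ Let $\Phi$ be the set of stochastic kernels $\varphi$ on $\mathcal U$ given $\mathcal S$ with $\varphi(\mathcal U(s)\mid s)=1$ for all $s$. Let $\mathcal M_{\mathbb P}(X)$ be the space of probability measures on $X$ with the $\sigma$-algebra generated by the evaluations $\mu\mapsto\mu(A)$ (the Borel $\sigma$-algebra of weak convergence). The measurized model has states $\nu\in\mathcal M_{\mathbb P}(\mathcal S)$, every $\varphi\in\Phi$ is feasible in every state, the next state is $$F(\nu,\varphi)(\cdot)=\int_{\mathcal S}\int_{\mathcal U}Q(\cdot\mid s,u)\,\varphi(du\mid s)\,d\nu(s),$$ and the reward is $\overline r(\nu,\varphi)=\int_{\mathcal S}\int_{\mathcal U}r(s,u)\,\varphi(du\mid s)\,d\nu(s)$. Its optimal value function $\overline V^*(\nu)$ is the supremum of the expected value of $\sum_t\alpha^t\overline r(\nu_t,\varphi_t)$ over all randomized history-dependent policies of the measurized model started at $\nu_0=\nu$; here the action $\varphi$ in the state $\nu$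 is identified with the joint law $\varphi(du\mid s)\,\nu(ds)\in\mathcal M_{\mathbb P}(\mathcal S\times\mathcal U)$, so that the feasible actions in $\nu$ form the set $\{\varphi(du\mid s)\nu(ds):\varphi\in\Phi\}$. **Theorem.** Let $\alpha\in[0,1)$ and suppose that 1. $r$ is upper semicontinuous and bounded above on $\mathbb K$, and $\{u\in\mathcal U(s): r(s,u)\ge c\}$ is compact for all $s\in\mathcal S$, $c\in\mathbb R$; 2. $Q$ is strongly continuous: $(s,u)\mapsto\int g(s')\,Q(ds'\mid s,u)$ is continuous on $\mathbb K$ for every bounded measurable $g:\mathcal S\to\mathbb R$; 3. there is a policy $\pi\in\Pi$ with $V(\pi,s)<\infty$ for all $s\in\mathcal S$; 4. $r$ is bounded below on $\mathbb K$; 5. $\{(s,u)\in\mathbb K: s\in\mathcal C\}$ is compact for every compact $\mathcal C\subseteq\mathcal S$. Then $V^*$ is the unique bounded measurable solution of $$V^*(s)=\sup_{u\in\mathcal U(s)}\Big\{r(s,u)+\alpha\int_{\mathcal S}V^*(s')\,Q(ds'\mid s,u)\Big\}\qquad(s\in\mathcal S),$$ $\overline V^*$ is the unique bounded measurable solution of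 $$\overline V^*(\nu)=\sup_{\varphi\in\Phi}\big\{\overline r(\nu,\varphi)+\alpha\,\overline V^*(F(\nu,\varphi))\big\}\qquad(\nu\in\mathcal M_{\mathbb P}(\mathcal S)),$$ and it also equals the supremum over deterministic control sequences, $$\overline V^*(\nu)=\sup_{(\varphi_t)_{t\ge0}\in\Phi^{\mathbb N}}\ \sum_{t=0}^\infty\alpha^t\,\overline r(\nu_t,\varphi_t),\qquad \nu_0=\nu,\quad \nu_{t+1}=F(\nu_t,\varphi_t).$$ Moreover, (a) $\overline V^*(\delta_s)=V^*(s)$ for all $s\in\mathcal S$; (b) $\overline V^*(\nu)=\int_{\mathcal S}V^*(s)\,d\nu(s)$ for all $\nu\in\mathcal M_{\mathbb P}(\mathcal S)$. -/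

import Mathlib

open MeasureTheory ProbabilityTheory

/-- A Markov decision model with state space `S` and action space `U`: nonempty sets of feasible
actions whose graph is measurable, a transition law and a one-stage reward. The transition law and
the reward only matter at feasible state-action pairs; they are represented by measurable functions
on all of `S × U`, their values off the feasible pairs are arbitrary and never used. -/
structure MDM (S U : Type*) [MeasurableSpace S] [MeasurableSpace U] where
  /-- the set of feasible actions in a state -/
  admissible : S → Set U
  /-- the transition law -/
  transition : Kernel (S × U) S
  /-- the reward per stage -/
  reward : S × U → ℝ
  admissible_nonempty : ∀ s, (admissible s).Nonempty
  measurableSet_graph : MeasurableSet {p : S × U | p.2 ∈ admissible p.1}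
  isMarkovKernel_transition : IsMarkovKernel transition
  measurable_reward : Measurable reward

namespace MDM

section Basic

variable {S U : Type*} [MeasurableSpace S] [MeasurableSpace U]

attribute [instance] MDM.isMarkovKernel_transition

/-- The set of feasible state-action pairs. -/
def feasible (M : MDM S U) : Set (S × U) := {p | p.2 ∈ M.admissible p.1}

/-- A randomized history-dependent control policy. The history at time `0` is the initial state;
the history at time `n + 1` consists of the pairs `(s_0,u_0), …, (s_n,u_n)` and of the current
state. The policy selects feasible actions along every admissible history. -/
structure Policy (M : MDM S U) where
  /-- the law of the action at time `0`, given the initial state -/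
  init : Kernel S U
  /-- the law of the action at time `n + 1`, given the history at that time -/
  next : (n : ℕ) → Kernel ((Finset.Iic n → S × U) × S) U
  isMarkovKernel_init : IsMarkovKernel init
  isMarkovKernel_next : ∀ n, IsMarkovKernel (next n)
  init_admissible : ∀ s, init s (M.admissible s) = 1
  next_admissible : ∀ n h s, (∀ i, h i ∈ M.feasible) → next n (h, s) (M.admissible s) = 1

attribute [instance] Policy.isMarkovKernel_init Policy.isMarkovKernel_next

/-- The law of the state-action pair at time `n + 1` given the pairs up to time `n`: the state is
drawn from the transition law, then the action is drawn from the policy. -/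
noncomputable def Policy.step {M : MDM S U} (π : M.Policy) (n : ℕ) :
    Kernel (Finset.Iic n → S × U) (S × U) :=
  (M.transition.comap (fun h : Finset.Iic n → S × U => h ⟨n, Finset.mem_Iic.2 le_rfl⟩)
    (measurable_pi_apply _)) ⊗ₖ π.next n

instance {M : MDM S U} (π : M.Policy) (n : ℕ) : IsMarkovKernel (π.step n) := by
  unfold Policy.step; infer_instance

/-- The law of the controlled process `(s_t,u_t)_{t ≥ 0}` under the policy `π` when the initial
state has law `ν` (Ionescu-Tulcea). -/
noncomputable def Policy.law {M : MDM S U} (π : M.Policy) (ν : Measure S) :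
    Measure (ℕ → S × U) :=
  Kernel.trajMeasure (X := fun _ => S × U) (ν ⊗ₘ π.init) π.step

/-- The total discounted reward along a trajectory. -/
noncomputable def discountedReward (M : MDM S U) (α : ℝ) (ω : ℕ → S × U) : ℝ :=
  ∑' t, α ^ t * M.reward (ω t)

/-- The value of the policy `π` from the state `s`. -/
noncomputable def Policy.value {M : MDM S U} (π : M.Policy) (α : ℝ) (s : S) : ℝ :=
  ∫ ω, M.discountedReward α ω ∂π.law (Measure.dirac s)

/-- The optimal discounted value function: the supremum over all randomized history-dependent
policies. -/
noncomputable def optimalValue (M : MDM S U) (α : ℝ) (s : S) : ℝ :=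
  ⨆ π : M.Policy, π.value α s

/-- `V` is a bounded measurable solution of the discounted optimality equation
`V(s) = sup_{u ∈ U(s)} (r(s,u) + α ∫ V dQ(·|s,u))`. -/
def IsOptimalitySolution (M : MDM S U) (α : ℝ) (V : S → ℝ) : Prop :=
  Measurable V ∧ (∃ C, ∀ s, |V s| ≤ C) ∧
    ∀ s, IsLUB ((fun u => M.reward (s, u) + α * ∫ s', V s' ∂M.transition (s, u)) ''
      M.admissible s) (V s)

/-- A Markov decision rule: a stochastic kernel that selects feasible actions. -/
structure DecisionRule (M : MDM S U) where
  /-- the underlying kernel -/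
  kernel : Kernel S U
  isMarkovKernel : IsMarkovKernel kernel
  kernel_admissible : ∀ s, kernel s (M.admissible s) = 1

attribute [instance] DecisionRule.isMarkovKernel

/-- The one-stage conditions on a model: upper semicontinuous, bounded and sup-compact reward on
the feasible pairs, strongly continuous transition law, a policy with value less than `+∞` from
every state, and compactness of the set of feasible pairs over every compact set of states. -/
structure Conditions [TopologicalSpace S] [TopologicalSpace U] (M : MDM S U) (α : ℝ) : Prop where
  reward_usc : UpperSemicontinuousOn M.reward M.feasible
  reward_bddAbove : ∃ c, ∀ p ∈ M.feasible, M.reward p ≤ c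
  reward_supCompact : ∀ (s : S) (c : ℝ), IsCompact {u | u ∈ M.admissible s ∧ c ≤ M.reward (s, u)}
  transition_stronglyContinuous : ∀ g : S → ℝ, Measurable g → (∃ C, ∀ s, |g s| ≤ C) →
    ContinuousOn (fun p => ∫ s', g s' ∂M.transition p) M.feasible
  exists_policy : ∃ π : M.Policy, ∀ s,
    ∫⁻ ω, ENNReal.ofReal (M.discountedReward α ω) ∂π.law (Measure.dirac s) < ⊤
  reward_bddBelow : ∃ c, ∀ p ∈ M.feasible, c ≤ M.reward p
  feasible_compact : ∀ C : Set S, IsCompact C → IsCompact {p | p ∈ M.feasible ∧ p.1 ∈ C}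

/-- The first decision of a policy is a decision rule. -/
lemma Conditions.nonempty_decisionRule [TopologicalSpace S] [TopologicalSpace U] {M : MDM S U}
    {α : ℝ} (h : M.Conditions α) : Nonempty M.DecisionRule :=
  let ⟨π, _⟩ := h.exists_policy
  ⟨⟨π.init, inferInstance, π.init_admissible⟩⟩

/-! ### The measurized model -/

/-- The joint law of a state drawn from `ν` and an action drawn from the decision rule `φ`. -/
noncomputable def joint (M : MDM S U) (ν : ProbabilityMeasure S) (φ : M.DecisionRule) :
    ProbabilityMeasure (S × U) :=
  ⟨(ν : Measure S) ⊗ₘ φ.kernel, inferInstance⟩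

/-- The state law that follows a joint state-action law. -/
noncomputable def push (M : MDM S U) (γ : ProbabilityMeasure (S × U)) : ProbabilityMeasure S :=
  ⟨M.transition ∘ₘ (γ : Measure (S × U)), inferInstance⟩

/-- The deterministic transition `F(ν,φ)(·) = ∫ ∫ Q(·|s,u) φ(du|s) ν(ds)` of the measurized
model. -/
noncomputable def nextLaw (M : MDM S U) (ν : ProbabilityMeasure S) (φ : M.DecisionRule) :
    ProbabilityMeasure S :=
  M.push (M.joint ν φ)

/-- The reward `∫ ∫ r(s,u) φ(du|s) ν(ds)` of the measurized model. -/
noncomputable def meanReward (M : MDM S U) (ν : ProbabilityMeasure S) (φ : M.DecisionRule) : ℝ :=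
  ∫ s, ∫ u, M.reward (s, u) ∂φ.kernel s ∂(ν : Measure S)

/-- The path of state laws from `ν` under the sequence `φ` of decision rules. -/
noncomputable def lawPath (M : MDM S U) (ν : ProbabilityMeasure S) (φ : ℕ → M.DecisionRule) :
    ℕ → ProbabilityMeasure S
  | 0 => ν
  | t + 1 => M.nextLaw (M.lawPath ν φ t) (φ t)

/-- `W` is a bounded measurable solution of the measurized optimality equation
`W(ν) = sup_{φ ∈ Φ} (r̄(ν,φ) + α W(F(ν,φ)))`. -/
def IsMeasurizedSolution (M : MDM S U) (α : ℝ) (W : ProbabilityMeasure S → ℝ) : Prop :=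
  Measurable W ∧ (∃ C, ∀ ν, |W ν| ≤ C) ∧
    ∀ ν, IsLUB (Set.range fun φ : M.DecisionRule => M.meanReward ν φ + α * W (M.nextLaw ν φ)) (W ν)

lemma measurable_push (M : MDM S U) : Measurable M.push := by
  refine Measurable.subtype_mk ?_
  exact (Measure.measurable_bind' M.transition.measurable).comp measurable_subtype_coe

lemma measurable_integral_coe {T : Type*} [MeasurableSpace T] {f : T → ℝ} (hf : Measurable f) :
    Measurable fun γ : ProbabilityMeasure T => ∫ x, f x ∂(γ : Measure T) :=
  (StronglyMeasurable.integral_kernel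
    (κ := (⟨fun γ : ProbabilityMeasure T => (γ : Measure T), measurable_subtype_coe⟩ :
      Kernel (ProbabilityMeasure T) T)) hf.stronglyMeasurable).measurable

lemma measurableSet_fst_eq [StandardBorelSpace S] :
    MeasurableSet {p : ProbabilityMeasure S × ProbabilityMeasure (S × U) |
      (p.2 : Measure (S × U)).fst = p.1} := by
  have hf := measurableEmbedding_embeddingReal S
  set f := embeddingReal S
  set G : Measure S → ℚ → ENNReal := fun μ q => μ (f ⁻¹' Set.Iic (q : ℝ)) with hG
  have hGm : Measurable G :=
    measurable_pi_lambda _ fun q => Measure.measurable_coe (hf.measurable measurableSet_Iic)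
  have h1 : Measurable fun p : ProbabilityMeasure S × ProbabilityMeasure (S × U) =>
      G (p.2 : Measure (S × U)).fst :=
    hGm.comp ((Measure.measurable_map _ measurable_fst).comp
      (measurable_subtype_coe.comp measurable_snd))
  have h2 : Measurable fun p : ProbabilityMeasure S × ProbabilityMeasure (S × U) =>
      G (p.1 : Measure S) := hGm.comp (measurable_subtype_coe.comp measurable_fst)
  convert measurableSet_eq_fun h1 h2 using 1
  ext ⟨ν, γ⟩
  constructor
  · intro h
    simp only [Set.mem_ofPred_eq] at h ⊢
    rw [h]
  · intro h
    simp only [Set.mem_ofPred_eq] at h ⊢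
    have hmap : (γ : Measure (S × U)).fst.map f = (ν : Measure S).map f := by
      refine ext_of_generate_finite _ Real.borel_eq_generateFrom_Iic_rat Real.isPiSystem_Iic_rat
        ?_ ?_
      · intro s hs
        simp only [Set.mem_iUnion, Set.mem_singleton_iff] at hs
        obtain ⟨q, rfl⟩ := hs
        rw [Measure.map_apply hf.measurable measurableSet_Iic,
          Measure.map_apply hf.measurable measurableSet_Iic]
        exact congrFun h q
      · rw [Measure.map_apply hf.measurable .univ, Measure.map_apply hf.measurable .univ]
        simp
    rw [← hf.comap_map (γ : Measure (S × U)).fst, hmap, hf.comap_map]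

lemma measurableSet_feasible (M : MDM S U) : MeasurableSet M.feasible :=
  M.measurableSet_graph

/-- A joint law comes from a decision rule exactly when it has the right first marginal and charges
the feasible pairs only. -/
lemma exists_joint_iff [StandardBorelSpace S] [StandardBorelSpace U] (M : MDM S U)
    (hΦ : Nonempty M.DecisionRule) (ν : ProbabilityMeasure S) (γ : ProbabilityMeasure (S × U)) :
    (∃ φ : M.DecisionRule, γ = M.joint ν φ) ↔
      (γ : Measure (S × U)).fst = ν ∧ (γ : Measure (S × U)) M.feasible = 1 := by
  classical
  obtain ⟨φ₀⟩ := hΦ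
  constructor
  · rintro ⟨φ, rfl⟩
    refine ⟨Measure.fst_compProd _ _, ?_⟩
    change ((ν : Measure S) ⊗ₘ φ.kernel) M.feasible = 1
    rw [Measure.compProd_apply M.measurableSet_feasible]
    have : ∀ s, φ.kernel s (Prod.mk s ⁻¹' M.feasible) = 1 := φ.kernel_admissible
    simp [this]
  · rintro ⟨hfst, hK⟩
    have hne : Nonempty (S × U) := by
      by_contra hemp
      rw [not_nonempty_iff] at hemp
      rw [Set.eq_empty_of_isEmpty M.feasible] at hK
      simp at hK
    have : Nonempty U := hne.map Prod.snd
    set κ := (γ : Measure (S × U)).condKernel with hκ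
    have hdis : (ν : Measure S) ⊗ₘ κ = (γ : Measure (S × U)) := by
      rw [← hfst]; exact (γ : Measure (S × U)).disintegrate _
    set A : Set S := {s | κ s (Prod.mk s ⁻¹' M.feasible) = 1} with hA
    have hAm : MeasurableSet A :=
      (Kernel.measurable_kernel_prodMk_left M.measurableSet_feasible) (measurableSet_singleton 1)
    have hae : ∀ᵐ s ∂(ν : Measure S), s ∈ A := by
      have h0 : ∀ᵐ p ∂((ν : Measure S) ⊗ₘ κ), p ∈ M.feasible := by
        rw [hdis]
        exact (prob_compl_eq_zero_iff M.measurableSet_feasible).2 hK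
      filter_upwards [Measure.ae_ae_of_ae_compProd h0] with s hs
      exact (prob_compl_eq_zero_iff (measurable_prodMk_left M.measurableSet_feasible)).1 hs
    refine ⟨⟨Kernel.piecewise hAm κ φ₀.kernel, inferInstance, fun s => ?_⟩, ?_⟩
    · rw [Kernel.piecewise_apply]
      split_ifs with hs
      · exact hs
      · exact φ₀.kernel_admissible s
    · apply Subtype.ext
      change (γ : Measure (S × U)) = (ν : Measure S) ⊗ₘ Kernel.piecewise hAm κ φ₀.kernel
      rw [← hdis]
      refine Measure.compProd_congr ?_
      filter_upwards [hae] with s hs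
      rw [Kernel.piecewise_apply, if_pos hs]

/-- The measurized counterpart of a Markov decision model, as a Markov decision model again. A state
is a law `ν` on `S`; taking the decision rule `φ` in the state `ν` is represented by the joint
state-action law of `(ν,φ)`, which determines `φ` up to a `ν`-null set and carries the measurable
structure of the space of probability measures. The next state is deterministic and the reward is
the expected reward. -/
noncomputable def measurized [StandardBorelSpace S] [StandardBorelSpace U] (M : MDM S U)
    (hΦ : Nonempty M.DecisionRule) :
    MDM (ProbabilityMeasure S) (ProbabilityMeasure (S × U)) where
  admissible ν := Set.range (M.joint ν)
  transition := Kernel.deterministic (fun p => M.push p.2) (M.measurable_push.comp measurable_snd)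
  reward p := ∫ x, M.reward x ∂(p.2 : Measure (S × U))
  admissible_nonempty _ := Set.range_nonempty _
  measurableSet_graph := by
    have h : MeasurableSet {p : ProbabilityMeasure S × ProbabilityMeasure (S × U) |
        (p.2 : Measure (S × U)) M.feasible = 1} :=
      ((Measure.measurable_coe M.measurableSet_feasible).comp
        (measurable_subtype_coe.comp measurable_snd)) (measurableSet_singleton 1)
    convert measurableSet_fst_eq.inter h using 1
    ext ⟨ν, γ⟩
    simpa [eq_comm] using M.exists_joint_iff hΦ ν γ
  isMarkovKernel_transition := inferInstance
  measurable_reward := (measurable_integral_coe M.measurable_reward).comp measurable_snd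

end Basic

end MDM

/-! Strong continuity of `Q` makes `s, u ↦ ∫ V dQ` continuous on the feasible pairs for every
bounded measurable `V`, so `pairValue` is upper semicontinuous there with no regularity of `V`.
Compactness over compact sets of states then yields a measurable maximizer
(`UpperSemicontinuousOn.exists_measurable_maximizer`). Hence the Bellman operator preserves bounded
measurable functions; it contracts by `α`, and its fixed point `V` is attained by a decision rule
`φ`.

Verification (`optimalValue_eq`) uses only the inequality `pairValue ≤ V` and equality under `φ`.
Along any policy the expectations of `V (s_t)` satisfy a one-step inequality that telescopes to
value `≤ V`; under `φ` it is an equality. This identifies `V` with the optimal value, and gives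
uniqueness as well.

The measurized reward and transition are linear in the joint law. Integrating `pairValue ≤ V`
against a joint law with first marginal `ν` gives the measurized inequality for `ν ↦ ∫ V dν`, with
equality under the same `φ` for every `ν`. The measurized model is again a Markov decision model, so
the same verification applies to it, with no topological condition on spaces of measures. Part (b)
follows, and (a) is (b) at a Dirac mass. -/

/-! ### Measurable selectors of compact-valued maps -/

/-- A map with nonempty compact values whose hitting sets of closed sets are measurable. -/
structure MeasurableCompactValued {S U : Type*} [MeasurableSpace S] [TopologicalSpace U]
    (D : S → Set U) : Prop where
  nonempty : ∀ s, (D s).Nonempty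
  isCompact : ∀ s, IsCompact (D s)
  measurableSet_hit : ∀ F : Set U, IsClosed F → MeasurableSet {s | (D s ∩ F).Nonempty}

/-- The points of `D` that maximize `g`. -/
def argmaxOn {U : Type*} (D : Set U) (g : U → ℝ) : Set U := {u | u ∈ D ∧ ∀ v ∈ D, g v ≤ g u}

/-- The superlevel sets in `D ∩ F` at the rational levels reached on `D` are nested, compact and
nonempty; a common point lies in `F` and maximizes. Only countably many levels occur, which makes
hitting sets of the argmax measurable. -/
lemma argmaxOn_inter_nonempty_iff {U : Type*} [TopologicalSpace U] [T2Space U] {D F : Set U}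
    {g : U → ℝ} (hF : IsClosed F) (hc : ∀ c : ℝ, IsCompact {u | u ∈ D ∧ c ≤ g u})
    (hne : D.Nonempty) :
    (argmaxOn D g ∩ F).Nonempty ↔
      ∀ q : ℚ, (∃ u ∈ D, (q : ℝ) ≤ g u) → ∃ u ∈ D, u ∈ F ∧ (q : ℝ) ≤ g u := by
  constructor
  · rintro ⟨u, ⟨huD, hu⟩, huF⟩ q ⟨v, hv, hq⟩
    exact ⟨u, huD, huF, hq.trans (hu v hv)⟩
  · intro h
    let I := {q : ℚ // ∃ u ∈ D, (q : ℝ) ≤ g u}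
    have : Nonempty I := by
      obtain ⟨u, hu⟩ := hne
      obtain ⟨q, hq⟩ := exists_rat_lt (g u)
      exact ⟨⟨q, u, hu, hq.le⟩⟩
    let A : I → Set U := fun q => {u | u ∈ D ∧ (q.1 : ℝ) ≤ g u} ∩ F
    have hdir : Directed (· ⊇ ·) A := by
      intro p q
      rcases le_total p.1 q.1 with hpq | hpq
      · exact ⟨q, fun u hu => ⟨⟨hu.1.1, le_trans (by exact_mod_cast hpq) hu.1.2⟩, hu.2⟩, le_rfl⟩
      · exact ⟨p, le_rfl, fun u hu => ⟨⟨hu.1.1, le_trans (by exact_mod_cast hpq) hu.1.2⟩, hu.2⟩⟩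
    obtain ⟨u, hu⟩ := IsCompact.nonempty_iInter_of_directed_nonempty_isCompact_isClosed A hdir
      (fun q => by
        obtain ⟨u, h1, h2, h3⟩ := h q.1 q.2
        exact ⟨u, ⟨h1, h3⟩, h2⟩)
      (fun q => (hc q.1).inter_right hF) (fun q => ((hc q.1).inter_right hF).isClosed)
    rw [Set.mem_iInter] at hu
    obtain ⟨q₀⟩ := ‹Nonempty I›
    refine ⟨u, ⟨(hu q₀).1.1, fun v hv => ?_⟩, (hu q₀).2⟩
    exact le_of_forall_rat_lt_imp_le fun q hq => (hu ⟨q, v, hv, hq.le⟩).1.2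

lemma MeasurableCompactValued.argmax {S U : Type*} [MeasurableSpace S] [TopologicalSpace U]
    [T2Space U] {D : S → Set U} {g : S → U → ℝ} (hne : ∀ s, (D s).Nonempty)
    (hc : ∀ s (c : ℝ), IsCompact {u | u ∈ D s ∧ c ≤ g s u})
    (hm : ∀ F : Set U, IsClosed F → ∀ c : ℝ, MeasurableSet {s | ∃ u ∈ D s, u ∈ F ∧ c ≤ g s u}) :
    MeasurableCompactValued fun s => argmaxOn (D s) (g s) := by
  have hne' : ∀ s, (argmaxOn (D s) (g s)).Nonempty := fun s => by
    simpa using (argmaxOn_inter_nonempty_iff isClosed_univ (hc s) (hne s)).2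
      (fun q hq => by simpa using hq)
  refine ⟨hne', fun s => ?_, fun F hF => ?_⟩
  -- The argmax is the superlevel set at the maximal value.
  · obtain ⟨u₀, hu₀⟩ := hne' s
    convert hc s (g s u₀) using 1
    ext u
    exact ⟨fun hu => ⟨hu.1, hu.2 _ hu₀.1⟩, fun hu => ⟨hu.1, fun v hv => (hu₀.2 v hv).trans hu.2⟩⟩
  · simp_rw [argmaxOn_inter_nonempty_iff hF (hc _) (hne _)]
    rw [Set.ofPred_forall]
    refine MeasurableSet.iInter fun q => ?_
    refine MeasurableSet.imp ?_ (hm F hF q)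
    simpa using hm Set.univ isClosed_univ q

lemma MeasurableCompactValued.argmax_continuous {S U : Type*} [MeasurableSpace S]
    [TopologicalSpace U] [T2Space U] {D : S → Set U} (hD : MeasurableCompactValued D)
    {h : U → ℝ} (hh : Continuous h) :
    MeasurableCompactValued fun s => argmaxOn (D s) h :=
  MeasurableCompactValued.argmax (g := fun _ => h) hD.nonempty
    (fun s _ => (hD.isCompact s).inter_right (isClosed_le continuous_const hh))
    (fun _ hF _ => hD.measurableSet_hit _ (hF.inter (isClosed_le continuous_const hh)))

/-- A compact-valued measurable map has a measurable selector. -/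
lemma MeasurableCompactValued.exists_measurable_selector {S U : Type*} [MeasurableSpace S]
    [TopologicalSpace U] [TopologicalSpace.MetrizableSpace U] [SecondCountableTopology U]
    [MeasurableSpace U] [BorelSpace U] [StandardBorelSpace U] {D : S → Set U}
    (hD : MeasurableCompactValued D) : ∃ f : S → U, Measurable f ∧ ∀ s, f s ∈ D s := by
  rcases isEmpty_or_nonempty S with hS | ⟨⟨s₀⟩⟩
  · exact ⟨fun s => hS.elim s, measurable_of_empty _, fun s => hS.elim s⟩
  let := TopologicalSpace.metrizableSpaceMetric U
  have : Nonempty U := ⟨(hD.nonempty s₀).some⟩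
  let h : ℕ → U → ℝ := fun i u => dist u (TopologicalSpace.denseSeq U i)
  have hh : ∀ i, Continuous (h i) := fun i => continuous_id.dist continuous_const
  -- Successively keep the points farthest from the first, second, … point of a dense sequence.
  let E : ℕ → S → Set U := fun n => Nat.rec D (fun i A s => argmaxOn (A s) (h i)) n
  have hE : ∀ n, MeasurableCompactValued (E n) := by
    intro n
    induction n with
    | zero => exact hD
    | succ n ih => exact ih.argmax_continuous (hh n)
  have hsel : ∀ s, (⋂ n, E n s).Nonempty := fun s =>
    IsCompact.nonempty_iInter_of_sequence_nonempty_isCompact_isClosed (fun n => E n s)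
      (fun n u hu => hu.1) (fun n => (hE n).nonempty s) ((hE 0).isCompact s)
      (fun n => ((hE n).isCompact s).isClosed)
  choose f hf using hsel
  have hf : ∀ s n, f s ∈ E n s := fun s => Set.mem_iInter.1 (hf s)
  refine ⟨f, ?_, fun s => hf s 0⟩
  let e : U → ℕ → ℝ := fun u i => h i u
  have he : Measurable e := measurable_pi_lambda _ fun i => (hh i).measurable
  have hinj : Function.Injective e := by
    intro u v huv
    refine eq_of_forall_dist_le fun ε hε => ?_
    obtain ⟨i, hi⟩ := (TopologicalSpace.denseRange_denseSeq U).exists_dist_lt u (half_pos hε)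
    have h1 : dist u (TopologicalSpace.denseSeq U i) = dist v (TopologicalSpace.denseSeq U i) :=
      congrFun huv i
    have := dist_triangle_right u v (TopologicalSpace.denseSeq U i)
    linarith
  -- An injective measurable map out of a standard Borel space is a measurable embedding, so it
  -- suffices to check each distance to a dense point.
  rw [← (he.measurableEmbedding hinj).measurable_comp_iff]
  refine measurable_pi_lambda _ fun i => measurable_of_Ici fun c => ?_
  -- Membership in `E (i + 1) s` says that `f s` maximizes `h i` over `E i s`, so `c ≤ h i (f s)`
  -- means that `E i s` hits a closed set.
  convert (hE i).measurableSet_hit {u | c ≤ h i u} (isClosed_le continuous_const (hh i)) using 1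
  ext s
  exact ⟨fun hs => ⟨f s, hf s i, hs⟩, fun ⟨u, hu, hc⟩ => le_trans hc ((hf s (i + 1)).2 u hu)⟩

/-! ### Upper semicontinuous functions over compact sets of states -/

/-- The superlevel sets of an upper semicontinuous function on a set that is compact over compact
sets of states are again compact over compact sets of states. -/
lemma UpperSemicontinuousOn.isCompact_superlevel {S U : Type*} [TopologicalSpace S]
    [TopologicalSpace U] [T2Space S] [T2Space U] {K : Set (S × U)} {g : S × U → ℝ}
    (hK : ∀ C : Set S, IsCompact C → IsCompact {p | p ∈ K ∧ p.1 ∈ C})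
    (hg : UpperSemicontinuousOn g K) {F : Set U} (hF : IsClosed F) (c : ℝ) {C : Set S}
    (hC : IsCompact C) : IsCompact {p | p ∈ K ∧ p.1 ∈ C ∧ p.2 ∈ F ∧ c ≤ g p} := by
  have h1 : IsCompact ({p | p ∈ K ∧ p.1 ∈ C} ∩ Prod.snd ⁻¹' F) :=
    (hK C hC).inter_right (hF.preimage continuous_snd)
  have hg' : UpperSemicontinuousOn g ({p | p ∈ K ∧ p.1 ∈ C} ∩ Prod.snd ⁻¹' F) :=
    hg.mono fun p hp => hp.1.1
  obtain ⟨v, hv, hEq⟩ := upperSemicontinuousOn_iff_preimage_Ici.1 hg' c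
  convert h1.inter_right hv using 1
  rw [← hEq]
  ext p
  simp only [Set.mem_ofPred_eq, Set.mem_inter_iff, Set.mem_preimage, Set.mem_Ici]
  tauto

/-- A convergent sequence together with its limit is compact. The superlevel set over it is compact,
so its projection is closed and contains the limit. -/
lemma UpperSemicontinuousOn.isClosed_exists_superlevel {S U : Type*} [TopologicalSpace S]
    [TopologicalSpace U] [T2Space S] [T2Space U] [SequentialSpace S] {K : Set (S × U)}
    {g : S × U → ℝ} (hK : ∀ C : Set S, IsCompact C → IsCompact {p | p ∈ K ∧ p.1 ∈ C})
    (hg : UpperSemicontinuousOn g K) {F : Set U} (hF : IsClosed F) (c : ℝ) :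
    IsClosed {s | ∃ u, (s, u) ∈ K ∧ u ∈ F ∧ c ≤ g (s, u)} := by
  refine IsSeqClosed.isClosed fun x a hx hxa => ?_
  have h1 := (hg.isCompact_superlevel hK hF c hxa.isCompact_insert_range).image continuous_fst
  have h2 := h1.isClosed.mem_of_tendsto hxa (Filter.Eventually.of_forall fun n => by
    obtain ⟨u, h1, h2, h3⟩ := hx n
    exact ⟨(x n, u), ⟨h1, Or.inr ⟨n, rfl⟩, h2, h3⟩, rfl⟩)
  obtain ⟨⟨s, u⟩, ⟨h3, -, h4, h5⟩, rfl⟩ := h2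
  exact ⟨u, h3, h4, h5⟩

/-- An upper semicontinuous function on a set that is compact over compact sets of states has a
measurable maximizer. -/
lemma UpperSemicontinuousOn.exists_measurable_maximizer {S U : Type*}
    [TopologicalSpace S] [T2Space S] [SequentialSpace S] [MeasurableSpace S]
    [OpensMeasurableSpace S]
    [TopologicalSpace U] [TopologicalSpace.MetrizableSpace U] [SecondCountableTopology U]
    [MeasurableSpace U] [BorelSpace U] [StandardBorelSpace U] {K : Set (S × U)}
    {g : S × U → ℝ} (hne : ∀ s, ∃ u, (s, u) ∈ K)
    (hK : ∀ C : Set S, IsCompact C → IsCompact {p | p ∈ K ∧ p.1 ∈ C})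
    (hg : UpperSemicontinuousOn g K) :
    ∃ f : S → U, Measurable f ∧ ∀ s, (s, f s) ∈ K ∧ ∀ u, (s, u) ∈ K → g (s, u) ≤ g (s, f s) := by
  have hD : MeasurableCompactValued fun s =>
      argmaxOn {u | (s, u) ∈ K} fun u => g (s, u) := by
    refine MeasurableCompactValued.argmax hne (fun s c => ?_) fun F hF c =>
      (hg.isClosed_exists_superlevel hK hF c).measurableSet
    convert (hg.isCompact_superlevel hK isClosed_univ c (isCompact_singleton (x := s))).image
      continuous_snd using 1
    ext u
    constructor
    · exact fun hu => ⟨(s, u), ⟨hu.1, rfl, trivial, hu.2⟩, rfl⟩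
    · rintro ⟨⟨s', u'⟩, ⟨h1, rfl, -, h2⟩, rfl⟩
      exact ⟨h1, h2⟩
  obtain ⟨f, hf, hfs⟩ := hD.exists_measurable_selector
  exact ⟨f, hf, fun s => hfs s⟩

/-! ### Discounted sums and bounded integrals -/

lemma summable_discounted {α : ℝ} (hα₀ : 0 ≤ α) (hα₁ : α < 1) {a : ℕ → ℝ} {C : ℝ}
    (ha : ∀ t, |a t| ≤ C) : Summable fun t => α ^ t * a t := by
  refine Summable.of_norm_bounded ((summable_geometric_of_lt_one hα₀ hα₁).mul_right C) fun t => ?_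
  rw [norm_mul, Real.norm_eq_abs, Real.norm_eq_abs, abs_of_nonneg (pow_nonneg hα₀ t)]
  exact mul_le_mul_of_nonneg_left (ha t) (pow_nonneg hα₀ t)

/-- The weighted inequalities telescope, and the remainder `α ^ n * w n` vanishes because `w` is
bounded. -/
lemma tsum_discounted_le {α : ℝ} (hα₀ : 0 ≤ α) (hα₁ : α < 1) {a w : ℕ → ℝ} {C D : ℝ}
    (ha : ∀ t, |a t| ≤ C) (hw : ∀ t, |w t| ≤ D) (h : ∀ t, a t + α * w (t + 1) ≤ w t) :
    ∑' t, α ^ t * a t ≤ w 0 := by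
  have hpart : ∀ n, ∑ t ∈ Finset.range n, α ^ t * a t + α ^ n * w n ≤ w 0 := by
    intro n
    induction n with
    | zero => simp
    | succ n ih =>
      rw [Finset.sum_range_succ, pow_succ]
      have := mul_le_mul_of_nonneg_left (h n) (pow_nonneg hα₀ n)
      linarith
  have h0 : Filter.Tendsto (fun n => α ^ n * w n) Filter.atTop (nhds 0) :=
    (summable_discounted hα₀ hα₁ hw).tendsto_atTop_zero
  have h1 := ((summable_discounted hα₀ hα₁ ha).hasSum.tendsto_sum_nat).add h0
  rw [add_zero] at h1
  exact le_of_tendsto' h1 hpart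

lemma tsum_discounted_eq {α : ℝ} (hα₀ : 0 ≤ α) (hα₁ : α < 1) {a w : ℕ → ℝ} {C D : ℝ}
    (ha : ∀ t, |a t| ≤ C) (hw : ∀ t, |w t| ≤ D) (h : ∀ t, a t + α * w (t + 1) = w t) :
    ∑' t, α ^ t * a t = w 0 := by
  refine le_antisymm (tsum_discounted_le hα₀ hα₁ ha hw fun t => (h t).le) ?_
  have := tsum_discounted_le hα₀ hα₁ (a := fun t => -a t) (w := fun t => -w t)
    (by simpa using ha) (by simpa using hw) fun t => by linarith [h t]
  simp only [mul_neg, tsum_neg] at this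
  linarith

lemma integrable_of_bounded {T : Type*} [MeasurableSpace T] {μ : Measure T} [IsFiniteMeasure μ]
    {f : T → ℝ} (hf : Measurable f) {C : ℝ} (hC : ∀ x, |f x| ≤ C) : Integrable f μ :=
  Integrable.of_bound hf.aestronglyMeasurable C (Filter.Eventually.of_forall hC)

lemma integrable_comp_of_bounded {T T' : Type*} [MeasurableSpace T] [MeasurableSpace T']
    {μ : Measure T} [IsFiniteMeasure μ] {f : T' → ℝ} {g : T → T'} (hf : Measurable f)
    (hg : Measurable g) {C : ℝ} (hC : ∀ x, |f x| ≤ C) : Integrable (fun x => f (g x)) μ :=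
  integrable_of_bounded (hf.comp hg) fun x => hC (g x)

lemma abs_integral_le_of_ae {T : Type*} [MeasurableSpace T] {μ : Measure T}
    [IsProbabilityMeasure μ] {f : T → ℝ} {C : ℝ} (hC : ∀ᵐ x ∂μ, |f x| ≤ C) :
    |∫ x, f x ∂μ| ≤ C := by
  simpa using norm_integral_le_of_norm_le_const (f := f) (μ := μ) hC

/-! ### Trajectory laws and the verification theorem -/

/-- The first `n + 1` entries of a sequence. -/
def history {X : Type*} (n : ℕ) (ω : ℕ → X) : Finset.Iic n → X := fun i => ω i

lemma measurable_history {X : Type*} [MeasurableSpace X] (n : ℕ) :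
    Measurable (history n : (ℕ → X) → Finset.Iic n → X) :=
  measurable_pi_lambda _ fun _ => measurable_pi_apply _

namespace MDM

variable {S U : Type*} [MeasurableSpace S] [MeasurableSpace U] {M : MDM S U}

/-- The value of a state-action pair when the continuation values are `V`. -/
noncomputable def pairValue (M : MDM S U) (α : ℝ) (V : S → ℝ) (p : S × U) : ℝ :=
  M.reward p + α * ∫ s', V s' ∂M.transition p

lemma measurable_integral_transition (M : MDM S U) {V : S → ℝ} (hV : Measurable V) :
    Measurable fun p => ∫ s', V s' ∂M.transition p :=
  (StronglyMeasurable.integral_kernel hV.stronglyMeasurable).measurable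

lemma measurable_pairValue (M : MDM S U) (α : ℝ) {V : S → ℝ} (hV : Measurable V) :
    Measurable (M.pairValue α V) :=
  M.measurable_reward.add ((M.measurable_integral_transition hV).const_mul α)

lemma abs_integral_transition_le (M : MDM S U) {V : S → ℝ} {C : ℝ} (hC : ∀ s, |V s| ≤ C)
    (p : S × U) : |∫ s', V s' ∂M.transition p| ≤ C :=
  abs_integral_le_of_ae (Filter.Eventually.of_forall hC)

namespace Policy

variable (π : M.Policy) (ν : Measure S)

lemma map_law_zero : (π.law ν).map (fun ω => ω 0) = ν ⊗ₘ π.init := by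
  have h1 : (fun ω : ℕ → S × U => ω 0) =
      (fun h : Finset.Iic 0 → S × U => h ⟨0, Finset.mem_Iic.2 le_rfl⟩) ∘
        history 0 := rfl
  have h2 : (history 0 : (ℕ → S × U) → _) = Preorder.frestrictLe (π := fun _ => S × U) 0 := rfl
  rw [h1, ← Measure.map_map (measurable_pi_apply _) (measurable_history 0), h2, Policy.law, Kernel.trajMeasure, Measure.map_comp _ _ (by fun_prop),
    Kernel.traj_map_frestrictLe, Kernel.partialTraj_self, Measure.id_comp,
    Measure.map_map (measurable_pi_apply _) (MeasurableEquiv.measurable _)]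
  -- Evaluation at index `0` undoes the identification of a pair with a one-entry history.
  exact Measure.map_id

variable [IsProbabilityMeasure ν]

instance : IsProbabilityMeasure (π.law ν) := by
  unfold Policy.law; infer_instance

lemma map_law_succ (n : ℕ) :
    (π.law ν).map (fun ω => (history n ω, ω (n + 1))) =
      (π.law ν).map (history n) ⊗ₘ π.step n :=
  (Kernel.map_frestrictLe_trajMeasure_compProd_eq_map_trajMeasure (X := fun _ => S × U)).symm

/-- A measurable set of pairs from which the policy selects its actions, as long as the history is
in the set, contains the whole trajectory almost surely. -/
lemma ae_forall_mem_law {A : Set (S × U)} (hA : MeasurableSet A)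
    (h0 : ∀ s, ∀ᵐ u ∂π.init s, (s, u) ∈ A)
    (hn : ∀ n h s, (∀ i, h i ∈ A) → ∀ᵐ u ∂π.next n (h, s), (s, u) ∈ A) :
    ∀ᵐ ω ∂π.law ν, ∀ t, ω t ∈ A := by
  -- The hypothesis on `π.next` needs the whole history in `A`, so the induction carries all `t ≤
  -- n`.
  have key : ∀ n, ∀ᵐ ω ∂π.law ν, ∀ t ≤ n, ω t ∈ A := by
    intro n
    induction n with
    | zero =>
      have h1 : ∀ᵐ p ∂(π.law ν).map (fun ω => ω 0), p ∈ A := by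
        rw [map_law_zero]
        exact Measure.ae_compProd_of_ae_ae hA (Filter.Eventually.of_forall h0)
      filter_upwards [ae_of_ae_map (measurable_pi_apply 0).aemeasurable h1] with ω hω t ht
      rwa [Nat.le_zero.1 ht]
    | succ n ih =>
      have hmeas : MeasurableSet {h : Finset.Iic n → S × U | ∀ i, h i ∈ A} := by
        rw [Set.ofPred_forall]
        exact MeasurableSet.iInter fun i => measurable_pi_apply i hA
      have h1 : ∀ᵐ h ∂(π.law ν).map (history n),
          ∀ i, h i ∈ A := by
        rw [ae_map_iff (measurable_history n).aemeasurable hmeas]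
        filter_upwards [ih] with ω hω i
        exact hω i (Finset.mem_Iic.1 i.2)
      have h2 : ∀ᵐ p ∂(π.law ν).map
          (fun ω => (history n ω, ω (n + 1))), p.2 ∈ A := by
        rw [map_law_succ]
        refine Measure.ae_compProd_of_ae_ae (measurable_snd hA) ?_
        filter_upwards [h1] with h hh
        exact Kernel.ae_compProd_of_ae_ae hA (Filter.Eventually.of_forall fun s => hn n h s hh)
      filter_upwards [ih, ae_of_ae_map
        ((measurable_history n).prodMk (measurable_pi_apply _)).aemeasurable h2]
        with ω h3 h4 t ht
      rcases Nat.le_succ_iff.1 ht with ht | rfl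
      · exact h3 t ht
      · exact h4
  filter_upwards [ae_all_iff.2 key] with ω hω t
  exact hω t t le_rfl

/-- Turns bounds valid on feasible pairs only into almost sure bounds along trajectories. -/
lemma ae_forall_mem_feasible : ∀ᵐ ω ∂π.law ν, ∀ t, ω t ∈ M.feasible := by
  refine π.ae_forall_mem_law ν M.measurableSet_feasible (fun s => ?_) fun n h s hh => ?_
  · exact (prob_compl_eq_zero_iff (measurable_prodMk_left M.measurableSet_feasible)).2
      (π.init_admissible s)
  · exact (prob_compl_eq_zero_iff (measurable_prodMk_left M.measurableSet_feasible)).2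
      (π.next_admissible n h s hh)

lemma integral_law_zero {V : S → ℝ} (hV : Measurable V) :
    ∫ ω, V (ω 0).1 ∂π.law ν = ∫ s, V s ∂ν := by
  have hm : Measurable fun ω : ℕ → S × U => (ω 0).1 := (measurable_pi_apply 0).fst
  have h1 : (π.law ν).map (fun ω => (ω 0).1) = ν := by
    have : (fun ω : ℕ → S × U => (ω 0).1) = Prod.fst ∘ (fun ω => ω 0) := rfl
    rw [this, ← Measure.map_map measurable_fst (measurable_pi_apply 0), map_law_zero]
    exact Measure.fst_compProd _ _
  conv_rhs => rw [← h1]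
  exact (integral_map hm.aemeasurable hV.aestronglyMeasurable).symm

/-- The conditional law of the next state is given by the transition law. -/
lemma integral_law_succ {V : S → ℝ} (hV : Measurable V) {C : ℝ} (hC : ∀ s, |V s| ≤ C) (n : ℕ) :
    ∫ ω, V (ω (n + 1)).1 ∂π.law ν = ∫ ω, ∫ s', V s' ∂M.transition (ω n) ∂π.law ν := by
  have hm : Measurable fun ω : ℕ → S × U =>
      (history n ω, ω (n + 1)) :=
    (measurable_history n).prodMk (measurable_pi_apply _)
  have h1 : ∫ ω, V (ω (n + 1)).1 ∂π.law ν =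
      ∫ p, V p.2.1 ∂(π.law ν).map
        (fun ω => (history n ω, ω (n + 1))) :=
    (integral_map (f := fun p : (Finset.Iic n → S × U) × S × U => V p.2.1) hm.aemeasurable
      (hV.comp measurable_snd.fst).aestronglyMeasurable).symm
  have : IsProbabilityMeasure ((π.law ν).map (history n)) :=
    Measure.isProbabilityMeasure_map (measurable_history n).aemeasurable
  rw [h1, map_law_succ, Measure.integral_compProd
    (integrable_comp_of_bounded hV measurable_snd.fst hC)]
  have h2 : ∀ h : Finset.Iic n → S × U, ∫ p, V p.1 ∂π.step n h =
      ∫ s', V s' ∂M.transition (h ⟨n, Finset.mem_Iic.2 le_rfl⟩) := by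
    intro h
    have hint : Integrable (fun p : S × U => V p.1) (π.step n h) :=
      integrable_comp_of_bounded hV measurable_fst hC
    unfold Policy.step at hint ⊢
    rw [integral_compProd hint]
    -- `V` ignores the action, so the Markov kernel `π.next n` integrates out.
    simp [Kernel.comap_apply]
  simp_rw [h2]
  exact integral_map (measurable_history n).aemeasurable
    ((M.measurable_integral_transition hV).comp (measurable_pi_apply _)).aestronglyMeasurable

lemma abs_integral_reward_le {R : ℝ} (hR : ∀ p ∈ M.feasible, |M.reward p| ≤ R) (t : ℕ) :
    |∫ ω, M.reward (ω t) ∂π.law ν| ≤ R := by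
  refine abs_integral_le_of_ae ?_
  filter_upwards [π.ae_forall_mem_feasible ν] with ω hω using hR _ (hω t)

lemma integrable_reward {R : ℝ} (hR : ∀ p ∈ M.feasible, |M.reward p| ≤ R) (t : ℕ) :
    Integrable (fun ω => M.reward (ω t)) (π.law ν) := by
  refine Integrable.of_bound (M.measurable_reward.comp
    (measurable_pi_apply t)).aestronglyMeasurable R ?_
  filter_upwards [π.ae_forall_mem_feasible ν] with ω hω using hR _ (hω t)

/-- Sum and expectation commute because the terms are dominated by `α ^ t * R`. -/
lemma integral_discountedReward {α : ℝ} (hα₀ : 0 ≤ α) (hα₁ : α < 1) {R : ℝ}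
    (hR : ∀ p ∈ M.feasible, |M.reward p| ≤ R) :
    ∫ ω, M.discountedReward α ω ∂π.law ν = ∑' t, α ^ t * ∫ ω, M.reward (ω t) ∂π.law ν := by
  unfold discountedReward
  rw [← integral_tsum_of_summable_integral_norm
    (fun t => (π.integrable_reward ν hR t).const_mul (α ^ t))]
  · simp_rw [integral_const_mul]
  · simp_rw [norm_mul, integral_const_mul, Real.norm_eq_abs]
    refine (summable_discounted hα₀ hα₁ (C := R)
      (a := fun t => ∫ ω, |M.reward (ω t)| ∂π.law ν) fun t => ?_).congr fun t => ?_
    · refine abs_integral_le_of_ae ?_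
      filter_upwards [π.ae_forall_mem_feasible ν] with ω hω
      rw [abs_abs]
      exact hR _ (hω t)
    · rw [abs_of_nonneg (pow_nonneg hα₀ t)]

lemma integral_pairValue {α : ℝ} {R : ℝ} (hR : ∀ p ∈ M.feasible, |M.reward p| ≤ R)
    {V : S → ℝ} (hV : Measurable V) {C : ℝ} (hC : ∀ s, |V s| ≤ C) (t : ℕ) :
    ∫ ω, M.pairValue α V (ω t) ∂π.law ν =
      ∫ ω, M.reward (ω t) ∂π.law ν + α * ∫ ω, V (ω (t + 1)).1 ∂π.law ν := by
  unfold pairValue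
  rw [integral_add (π.integrable_reward ν hR t), integral_const_mul, π.integral_law_succ ν hV hC]
  exact (integrable_comp_of_bounded (M.measurable_integral_transition hV)
    (measurable_pi_apply t) (M.abs_integral_transition_le hC)).const_mul α

lemma integrable_pairValue {α : ℝ} {R : ℝ} (hR : ∀ p ∈ M.feasible, |M.reward p| ≤ R)
    {V : S → ℝ} (hV : Measurable V) {C : ℝ} (hC : ∀ s, |V s| ≤ C) (t : ℕ) :
    Integrable (fun ω => M.pairValue α V (ω t)) (π.law ν) :=
  (π.integrable_reward ν hR t).add
    ((integrable_comp_of_bounded (M.measurable_integral_transition hV)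
      (measurable_pi_apply t) (M.abs_integral_transition_le hC)).const_mul α)

/-- No policy has a larger value than a bounded supersolution of the optimality equation. -/
lemma value_le {α : ℝ} (hα₀ : 0 ≤ α) (hα₁ : α < 1) {R : ℝ}
    (hR : ∀ p ∈ M.feasible, |M.reward p| ≤ R) {V : S → ℝ} (hV : Measurable V) {C : ℝ}
    (hC : ∀ s, |V s| ≤ C) (hsup : ∀ p ∈ M.feasible, M.pairValue α V p ≤ V p.1) (s : S) :
    π.value α s ≤ V s := by
  have h := tsum_discounted_le hα₀ hα₁ (π.abs_integral_reward_le (Measure.dirac s) hR)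
    (w := fun t => ∫ ω, V (ω t).1 ∂π.law (Measure.dirac s)) (D := C)
    (fun t => abs_integral_le_of_ae (Filter.Eventually.of_forall fun ω => hC _)) fun t => by
      rw [← π.integral_pairValue _ hR hV hC]
      refine integral_mono_ae (π.integrable_pairValue _ hR hV hC t)
        (integrable_comp_of_bounded hV (measurable_pi_apply t).fst hC) ?_
      filter_upwards [π.ae_forall_mem_feasible (Measure.dirac s)] with ω hω using hsup _ (hω t)
  rw [π.integral_law_zero _ hV, integral_dirac' _ _ hV.stronglyMeasurable] at h
  rw [Policy.value, π.integral_discountedReward _ hα₀ hα₁ hR]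
  exact h

end Policy

/-- The policy that applies the same decision rule at every time. -/
noncomputable def DecisionRule.stationary (φ : M.DecisionRule) : M.Policy where
  init := φ.kernel
  next _ := φ.kernel.comap Prod.snd measurable_snd
  isMarkovKernel_init := inferInstance
  isMarkovKernel_next := inferInstance
  init_admissible := φ.kernel_admissible
  next_admissible _ _ s _ := φ.kernel_admissible s

/-- A decision rule that attains `V` in the optimality equation has the value `V`. -/
lemma DecisionRule.value_stationary (φ : M.DecisionRule) {α : ℝ} (hα₀ : 0 ≤ α) (hα₁ : α < 1)
    {R : ℝ} (hR : ∀ p ∈ M.feasible, |M.reward p| ≤ R) {V : S → ℝ} (hV : Measurable V) {C : ℝ}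
    (hC : ∀ s, |V s| ≤ C) (hφ : ∀ s, ∀ᵐ u ∂φ.kernel s, M.pairValue α V (s, u) = V s) (s : S) :
    φ.stationary.value α s = V s := by
  -- The stationary policy almost surely stays among the pairs at which `V` is attained.
  have hae := φ.stationary.ae_forall_mem_law (Measure.dirac s)
    (A := {p | M.pairValue α V p = V p.1})
    (measurableSet_eq_fun (M.measurable_pairValue α hV) (hV.comp measurable_fst)) hφ
    fun _ _ s _ => hφ s
  have h := tsum_discounted_eq hα₀ hα₁ (φ.stationary.abs_integral_reward_le (Measure.dirac s) hR)
    (w := fun t => ∫ ω, V (ω t).1 ∂φ.stationary.law (Measure.dirac s)) (D := C)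
    (fun t => abs_integral_le_of_ae (Filter.Eventually.of_forall fun ω => hC _)) fun t => by
      rw [← φ.stationary.integral_pairValue _ hR hV hC]
      refine integral_congr_ae ?_
      filter_upwards [hae] with ω hω using hω t
  rw [φ.stationary.integral_law_zero _ hV, integral_dirac' _ _ hV.stronglyMeasurable] at h
  rw [Policy.value, φ.stationary.integral_discountedReward _ hα₀ hα₁ hR]
  exact h

/-- Verification theorem: a bounded supersolution of the optimality equation that is attained by a
decision rule is the optimal value function. -/
lemma optimalValue_eq {α : ℝ} (hα₀ : 0 ≤ α) (hα₁ : α < 1) {R : ℝ}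
    (hR : ∀ p ∈ M.feasible, |M.reward p| ≤ R) {V : S → ℝ} (hV : Measurable V) {C : ℝ}
    (hC : ∀ s, |V s| ≤ C) (hsup : ∀ p ∈ M.feasible, M.pairValue α V p ≤ V p.1)
    (φ : M.DecisionRule) (hφ : ∀ s, ∀ᵐ u ∂φ.kernel s, M.pairValue α V (s, u) = V s) :
    M.optimalValue α = V := by
  funext s
  have hle : ∀ π : M.Policy, π.value α s ≤ V s := fun π => π.value_le hα₀ hα₁ hR hV hC hsup s
  -- A real supremum over an empty or unbounded family is `0` by default; `φ.stationary` and the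
  -- bound `V s` exclude both cases.
  have : Nonempty M.Policy := ⟨φ.stationary⟩
  refine le_antisymm (ciSup_le hle) ?_
  rw [← φ.value_stationary hα₀ hα₁ hR hV hC hφ s]
  exact le_ciSup (f := fun π : M.Policy => π.value α s) ⟨V s, by rintro _ ⟨π, rfl⟩; exact hle π⟩
    φ.stationary

end MDM

/-! ### The Bellman operator: contraction, fixed point, attainment -/

namespace MDM

section Contraction

variable {S U : Type*} [MeasurableSpace S] [MeasurableSpace U] {M : MDM S U} {α : ℝ}

/-- The transition law has mass one, so a constant added to the continuation values emerges
multiplied by `α`. -/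
lemma pairValue_le_add (hα₀ : 0 ≤ α) {V W : S → ℝ} (hV : Measurable V) (hW : Measurable W)
    {C C' D : ℝ} (hC : ∀ s, |V s| ≤ C) (hC' : ∀ s, |W s| ≤ C') (hD : ∀ s, V s ≤ W s + D)
    (p : S × U) : M.pairValue α V p ≤ M.pairValue α W p + α * D := by
  have h : ∫ s', V s' ∂M.transition p ≤ ∫ s', W s' ∂M.transition p + D := by
    have h1 := integral_mono (μ := M.transition p) (integrable_of_bounded hV hC)
      ((integrable_of_bounded hW hC').add (integrable_const D)) hD
    refine h1.trans_eq ?_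
    simp only [Pi.add_apply]
    rw [integral_add (integrable_of_bounded hW hC') (integrable_const D)]
    simp
  have := mul_le_mul_of_nonneg_left h hα₀
  unfold pairValue
  linarith

/-- The one-sided contraction estimate for the Bellman operator. -/
lemma le_add_of_isLUB (hα₀ : 0 ≤ α) {V W V' W' : S → ℝ} (hV : Measurable V)
    (hW : Measurable W) {C C' D : ℝ} (hC : ∀ s, |V s| ≤ C) (hC' : ∀ s, |W s| ≤ C')
    (hD : ∀ s, V s ≤ W s + D)
    (hV' : ∀ s, IsLUB ((fun u => M.pairValue α V (s, u)) '' M.admissible s) (V' s))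
    (hW' : ∀ s, IsLUB ((fun u => M.pairValue α W (s, u)) '' M.admissible s) (W' s)) (s : S) :
    V' s ≤ W' s + α * D := by
  refine (hV' s).2 ?_
  rintro _ ⟨u, hu, rfl⟩
  refine (pairValue_le_add hα₀ hV hW hC hC' hD _).trans ?_
  have := (hW' s).1 ⟨u, hu, rfl⟩
  simp only at this
  linarith

lemma abs_sub_le_of_isLUB (hα₀ : 0 ≤ α) {V W V' W' : S → ℝ} (hV : Measurable V)
    (hW : Measurable W) {C C' D : ℝ} (hC : ∀ s, |V s| ≤ C) (hC' : ∀ s, |W s| ≤ C')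
    (hD : ∀ s, |V s - W s| ≤ D)
    (hV' : ∀ s, IsLUB ((fun u => M.pairValue α V (s, u)) '' M.admissible s) (V' s))
    (hW' : ∀ s, IsLUB ((fun u => M.pairValue α W (s, u)) '' M.admissible s) (W' s)) (s : S) :
    |V' s - W' s| ≤ α * D := by
  have h1 := le_add_of_isLUB hα₀ hV hW hC hC'
    (D := D) (fun s => by linarith [(abs_le.1 (hD s)).2]) hV' hW' s
  have h2 := le_add_of_isLUB hα₀ hW hV hC' hC
    (D := D) (fun s => by linarith [(abs_le.1 (hD s)).1]) hW' hV' s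
  rw [abs_le]
  constructor <;> linarith

lemma IsOptimalitySolution.pairValue_le {V : S → ℝ} (hV : M.IsOptimalitySolution α V) {p : S × U}
    (hp : p ∈ M.feasible) : M.pairValue α V p ≤ V p.1 :=
  (hV.2.2 p.1).1 ⟨p.2, hp, rfl⟩

/-- The decision rule that applies a measurable selector of feasible actions. -/
noncomputable def DecisionRule.ofSelector (f : S → U) (hf : Measurable f)
    (hfs : ∀ s, f s ∈ M.admissible s) : M.DecisionRule where
  kernel := Kernel.deterministic f hf
  isMarkovKernel := inferInstance
  kernel_admissible s := by
    rw [Kernel.deterministic_apply]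
    exact Measure.dirac_apply_of_mem (hfs s)

end Contraction

/-- Iterating the contraction bounds the difference by `α ^ n * C` for every `n`. -/
lemma eq_of_abs_sub_le_mul {T : Type*} {α : ℝ} (hα₀ : 0 ≤ α) (hα₁ : α < 1) {V W : T → ℝ} {C : ℝ}
    (hC : ∀ x, |V x - W x| ≤ C)
    (h : ∀ D, (∀ x, |V x - W x| ≤ D) → ∀ x, |V x - W x| ≤ α * D) : V = W := by
  have key : ∀ n : ℕ, ∀ x, |V x - W x| ≤ α ^ n * C := by
    intro n
    induction n with
    | zero => simpa using hC
    | succ n ih =>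
      intro x
      rw [pow_succ', mul_assoc]
      exact h _ ih x
  funext x
  have hlim : Filter.Tendsto (fun n => α ^ n * C) Filter.atTop (nhds 0) := by
    simpa using (tendsto_pow_atTop_nhds_zero_of_lt_one hα₀ hα₁).mul_const C
  have := ge_of_tendsto' hlim fun n => key n x
  exact sub_eq_zero.1 (abs_nonpos_iff.1 this)

section Existence

variable {S U : Type*} [MeasurableSpace S] [MeasurableSpace U]
  [TopologicalSpace S] [TopologicalSpace U] {M : MDM S U} {α : ℝ}

lemma Conditions.exists_abs_reward_le (hM : M.Conditions α) :
    ∃ R, ∀ p ∈ M.feasible, |M.reward p| ≤ R := by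
  obtain ⟨b, hb⟩ := hM.reward_bddAbove
  obtain ⟨a, ha⟩ := hM.reward_bddBelow
  refine ⟨max |a| |b|, fun p hp => ?_⟩
  exact abs_le_max_abs_abs (ha p hp) (hb p hp)

/-- Strong rather than weak continuity of the transition law is what allows a merely measurable `V`.
-/
lemma Conditions.upperSemicontinuousOn_pairValue (hM : M.Conditions α) {V : S → ℝ}
    (hV : Measurable V) {C : ℝ} (hC : ∀ s, |V s| ≤ C) :
    UpperSemicontinuousOn (M.pairValue α V) M.feasible :=
  hM.reward_usc.add ((continuousOn_const.mul
    (hM.transition_stronglyContinuous V hV ⟨C, hC⟩)).upperSemicontinuousOn)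

variable [TopologicalSpace.MetrizableSpace S] [OpensMeasurableSpace S]
  [TopologicalSpace.MetrizableSpace U] [SecondCountableTopology U] [BorelSpace U]
  [StandardBorelSpace U]

/-- A measurable selector of optimal actions for the continuation values `V`. -/
lemma Conditions.exists_maximizer (hM : M.Conditions α) {V : S → ℝ}
    (hV : Measurable V) {C : ℝ} (hC : ∀ s, |V s| ≤ C) :
    ∃ f : S → U, Measurable f ∧ ∀ s, (s, f s) ∈ M.feasible ∧
      ∀ u, (s, u) ∈ M.feasible → M.pairValue α V (s, u) ≤ M.pairValue α V (s, f s) :=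
  (hM.upperSemicontinuousOn_pairValue hV hC).exists_measurable_maximizer
    M.admissible_nonempty hM.feasible_compact

/-- The Bellman operator preserves bounded measurable functions. -/
lemma Conditions.exists_bellman (hM : M.Conditions α) (hα₀ : 0 ≤ α) {V : S → ℝ}
    (hV : Measurable V) {C : ℝ} (hC : ∀ s, |V s| ≤ C) :
    ∃ W : S → ℝ, Measurable W ∧ (∃ C', ∀ s, |W s| ≤ C') ∧
      ∀ s, IsGreatest ((fun u => M.pairValue α V (s, u)) '' M.admissible s) (W s) := by
  obtain ⟨f, hf, hfs⟩ := hM.exists_maximizer hV hC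
  obtain ⟨R, hR⟩ := hM.exists_abs_reward_le
  refine ⟨fun s => M.pairValue α V (s, f s),
    (M.measurable_pairValue α hV).comp (measurable_id.prodMk hf), ⟨R + α * C, fun s => ?_⟩,
    fun s => ⟨⟨f s, (hfs s).1, rfl⟩, ?_⟩⟩
  · refine (abs_add_le _ _).trans (add_le_add (hR _ (hfs s).1) ?_)
    rw [abs_mul, abs_of_nonneg hα₀]
    exact mul_le_mul_of_nonneg_left (M.abs_integral_transition_le hC _) hα₀
  · rintro _ ⟨u, hu, rfl⟩
    exact (hfs s).2 u hu

/-- The optimality equation has a bounded measurable solution. -/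
lemma Conditions.exists_isOptimalitySolution (hM : M.Conditions α) (hα₀ : 0 ≤ α) (hα₁ : α < 1) :
    ∃ V, M.IsOptimalitySolution α V := by
  let B := {V : S → ℝ // Measurable V ∧ ∃ C, ∀ s, |V s| ≤ C}
  have hT : ∀ V : B, ∃ W : B, ∀ s,
      IsGreatest ((fun u => M.pairValue α V.1 (s, u)) '' M.admissible s) (W.1 s) := by
    rintro ⟨V, hV, C, hC⟩
    obtain ⟨W, hW, hb, hs⟩ := hM.exists_bellman hα₀ hV hC
    exact ⟨⟨W, hW, hb⟩, hs⟩
  choose T hT using hT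
  have hlub : ∀ (V : B) s, IsLUB ((fun u => M.pairValue α V.1 (s, u)) '' M.admissible s)
      ((T V).1 s) := fun V s => (hT V s).isLUB
  have hcontr : ∀ (V W : B) D, (∀ s, |V.1 s - W.1 s| ≤ D) →
      ∀ s, |(T V).1 s - (T W).1 s| ≤ α * D := by
    intro V W D hD
    obtain ⟨C, hC⟩ := V.2.2
    obtain ⟨C', hC'⟩ := W.2.2
    exact abs_sub_le_of_isLUB hα₀ V.2.1 W.2.1 hC hC' hD (hlub V) (hlub W)
  let v : ℕ → B := fun n => Nat.rec ⟨fun _ => 0, measurable_const, 0, by simp⟩ (fun _ => T) n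
  -- The iteration starts at the zero function, so a bound `D` on the first iterate bounds the first
  -- step.
  obtain ⟨D, hD⟩ := (v 1).2.2
  have hstep : ∀ n s, dist ((v n).1 s) ((v (n + 1)).1 s) ≤ D * α ^ n := by
    intro n
    induction n with
    | zero => intro s; simpa [v, Real.dist_eq] using hD s
    | succ n ih =>
      intro s
      refine (hcontr (v n) (v (n + 1)) _ ih s).trans_eq ?_
      ring
  have hcauchy : ∀ s, CauchySeq fun n => (v n).1 s := fun s =>
    cauchySeq_of_le_geometric α D hα₁ fun n => hstep n s
  choose V hVlim using fun s => cauchySeq_tendsto_of_complete (hcauchy s)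
  have hdist : ∀ n s, |(v n).1 s - V s| ≤ D * α ^ n / (1 - α) := fun n s =>
    dist_le_of_le_geometric_of_tendsto α D hα₁ (fun n => hstep n s) (hVlim s) n
  have hVm : Measurable V := measurable_of_tendsto_metrizable (fun n => (v n).2.1)
    (tendsto_pi_nhds.2 hVlim)
  -- The case `n = 0` of `hdist` bounds `V` itself, since the iterate is zero.
  have hVb : ∃ C, ∀ s, |V s| ≤ C := ⟨D / (1 - α), fun s => by
    simpa [v] using hdist 0 s⟩
  let V₀ : B := ⟨V, hVm, hVb⟩
  have hfix : T V₀ = V₀ := by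
    apply Subtype.ext
    funext s
    -- The iterates `v (n + 1) = T (v n)` converge both to `T V₀`, by contraction, and to `V`.
    refine tendsto_nhds_unique (f := fun n => (v (n + 1)).1 s) ?_
      ((hVlim s).comp (Filter.tendsto_add_atTop_nat 1))
    rw [tendsto_iff_dist_tendsto_zero]
    refine squeeze_zero (fun n => dist_nonneg)
      (fun n => hcontr (v n) V₀ _ (hdist n) s) ?_
    have h0 : Filter.Tendsto (fun n : ℕ => α * (D * α ^ n / (1 - α))) Filter.atTop
        (nhds (α * (D * 0 / (1 - α)))) :=
      (((tendsto_pow_atTop_nhds_zero_of_lt_one hα₀ hα₁).const_mul D).div_const _).const_mul α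
    simpa using h0
  refine ⟨V, hVm, hVb, fun s => ?_⟩
  have := hlub V₀ s
  rwa [hfix] at this

/-- The maximum in the optimality equation is attained by a measurable selector. -/
lemma Conditions.exists_optimal_selector (hM : M.Conditions α) {V : S → ℝ}
    (hV : M.IsOptimalitySolution α V) :
    ∃ f : S → U, Measurable f ∧ (∀ s, f s ∈ M.admissible s) ∧
      ∀ s, M.pairValue α V (s, f s) = V s := by
  obtain ⟨C, hC⟩ := hV.2.1
  obtain ⟨f, hf, hfs⟩ := hM.exists_maximizer hV.1 hC
  refine ⟨f, hf, fun s => (hfs s).1, fun s => IsLUB.unique (IsGreatest.isLUB ?_) (hV.2.2 s)⟩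
  refine ⟨⟨f s, (hfs s).1, rfl⟩, ?_⟩
  rintro _ ⟨u, hu, rfl⟩
  exact (hfs s).2 u hu

/-- A decision rule that attains the maximum in the optimality equation. -/
lemma Conditions.exists_optimal_decisionRule (hM : M.Conditions α) {V : S → ℝ}
    (hV : M.IsOptimalitySolution α V) :
    ∃ φ : M.DecisionRule, ∀ s, ∀ᵐ u ∂φ.kernel s, M.pairValue α V (s, u) = V s := by
  obtain ⟨f, hf, hfs, hfV⟩ := hM.exists_optimal_selector hV
  refine ⟨.ofSelector f hf hfs, fun s => ?_⟩
  have hm : MeasurableSet {u | M.pairValue α V (s, u) = V s} :=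
    measurableSet_eq_fun ((M.measurable_pairValue α hV.1).comp measurable_prodMk_left)
      measurable_const
  change ∀ᵐ u ∂(Kernel.deterministic f hf s), _
  rw [Kernel.deterministic_apply, ae_dirac_iff hm]
  exact hfV s

/-- Holding for an arbitrary solution, this also gives uniqueness in the optimality equation. -/
lemma Conditions.optimalValue_eq (hM : M.Conditions α) (hα₀ : 0 ≤ α) (hα₁ : α < 1) {V : S → ℝ}
    (hV : M.IsOptimalitySolution α V) : M.optimalValue α = V := by
  obtain ⟨φ, hφ⟩ := hM.exists_optimal_decisionRule hV
  obtain ⟨R, hR⟩ := hM.exists_abs_reward_le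
  obtain ⟨C, hC⟩ := hV.2.1
  exact MDM.optimalValue_eq hα₀ hα₁ hR hV.1 hC (fun p hp => hV.pairValue_le hp) φ hφ

end Existence

end MDM

/-! ### The measurized model -/

namespace MDM

section Measurized

variable {S U : Type*} [MeasurableSpace S] [MeasurableSpace U] {M : MDM S U} {α : ℝ}

lemma ae_joint_mem_feasible (ν : ProbabilityMeasure S) (φ : M.DecisionRule) :
    ∀ᵐ p ∂(M.joint ν φ : Measure (S × U)), p ∈ M.feasible :=
  Measure.ae_compProd_of_ae_ae M.measurableSet_feasible (Filter.Eventually.of_forall fun s =>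
    (prob_compl_eq_zero_iff (measurable_prodMk_left M.measurableSet_feasible)).2
      (φ.kernel_admissible s))

lemma integrable_reward_joint {R : ℝ} (hR : ∀ p ∈ M.feasible, |M.reward p| ≤ R)
    (ν : ProbabilityMeasure S) (φ : M.DecisionRule) :
    Integrable M.reward (M.joint ν φ : Measure (S × U)) := by
  refine Integrable.of_bound M.measurable_reward.aestronglyMeasurable R ?_
  filter_upwards [ae_joint_mem_feasible ν φ] with p hp using hR p hp

lemma integral_reward_joint {R : ℝ} (hR : ∀ p ∈ M.feasible, |M.reward p| ≤ R)
    (ν : ProbabilityMeasure S) (φ : M.DecisionRule) :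
    ∫ p, M.reward p ∂(M.joint ν φ : Measure (S × U)) = M.meanReward ν φ :=
  Measure.integral_compProd (integrable_reward_joint hR ν φ)

lemma abs_meanReward_le {R : ℝ} (hR : ∀ p ∈ M.feasible, |M.reward p| ≤ R)
    (ν : ProbabilityMeasure S) (φ : M.DecisionRule) : |M.meanReward ν φ| ≤ R := by
  rw [← integral_reward_joint hR]
  refine abs_integral_le_of_ae ?_
  filter_upwards [ae_joint_mem_feasible ν φ] with p hp using hR p hp

lemma integral_fst_joint {V : S → ℝ} (hV : Measurable V) (ν : ProbabilityMeasure S)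
    (φ : M.DecisionRule) :
    ∫ p, V p.1 ∂(M.joint ν φ : Measure (S × U)) = ∫ s, V s ∂(ν : Measure S) := by
  have h1 : (M.joint ν φ : Measure (S × U)).map Prod.fst = ν := Measure.fst_compProd _ _
  conv_rhs => rw [← h1]
  exact (integral_map measurable_fst.aemeasurable hV.aestronglyMeasurable).symm

lemma integral_nextLaw {V : S → ℝ} (hV : Measurable V) {C : ℝ} (hC : ∀ s, |V s| ≤ C)
    (ν : ProbabilityMeasure S) (φ : M.DecisionRule) :
    ∫ s, V s ∂(M.nextLaw ν φ : Measure S) =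
      ∫ p, ∫ s', V s' ∂M.transition p ∂(M.joint ν φ : Measure (S × U)) := by
  have hint : Integrable V (M.transition ∘ₘ (M.joint ν φ : Measure (S × U))) :=
    integrable_of_bounded hV hC
  change ∫ s, V s ∂(M.transition ∘ₘ (M.joint ν φ : Measure (S × U))) = _
  rw [Measure.comp_eq_comp_const_apply] at hint ⊢
  rw [Kernel.integral_comp hint, Kernel.const_apply]

/-- The right-hand side of the measurized optimality equation at `ν ↦ ∫ V dν`. -/
lemma meanReward_add_integral_nextLaw {R : ℝ} (hR : ∀ p ∈ M.feasible, |M.reward p| ≤ R)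
    {V : S → ℝ} (hV : Measurable V) {C : ℝ} (hC : ∀ s, |V s| ≤ C) (ν : ProbabilityMeasure S)
    (φ : M.DecisionRule) :
    M.meanReward ν φ + α * ∫ s, V s ∂(M.nextLaw ν φ : Measure S) =
      ∫ p, M.pairValue α V p ∂(M.joint ν φ : Measure (S × U)) := by
  unfold pairValue
  rw [integral_add (integrable_reward_joint hR ν φ), integral_const_mul, integral_nextLaw hV hC,
    integral_reward_joint hR]
  exact (integrable_of_bounded (M.measurable_integral_transition hV)
    (M.abs_integral_transition_le hC)).const_mul α

/-- The pointwise Bellman inequality is integrated against the joint law, which charges only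
feasible pairs and has first marginal `ν`. -/
lemma meanReward_add_le {R : ℝ} (hR : ∀ p ∈ M.feasible, |M.reward p| ≤ R)
    {V : S → ℝ} (hV : Measurable V) {C : ℝ} (hC : ∀ s, |V s| ≤ C)
    (hsup : ∀ p ∈ M.feasible, M.pairValue α V p ≤ V p.1) (ν : ProbabilityMeasure S)
    (φ : M.DecisionRule) :
    M.meanReward ν φ + α * ∫ s, V s ∂(M.nextLaw ν φ : Measure S) ≤ ∫ s, V s ∂(ν : Measure S) := by
  rw [meanReward_add_integral_nextLaw hR hV hC, ← integral_fst_joint hV ν φ]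
  refine integral_mono_ae ((integrable_reward_joint hR ν φ).add
    ((integrable_of_bounded (M.measurable_integral_transition hV)
      (M.abs_integral_transition_le hC)).const_mul α))
    (integrable_comp_of_bounded hV measurable_fst hC) ?_
  filter_upwards [ae_joint_mem_feasible ν φ] with p hp using hsup p hp

lemma meanReward_add_eq {R : ℝ} (hR : ∀ p ∈ M.feasible, |M.reward p| ≤ R)
    {V : S → ℝ} (hV : Measurable V) {C : ℝ} (hC : ∀ s, |V s| ≤ C) {φ : M.DecisionRule}
    (hφ : ∀ s, ∀ᵐ u ∂φ.kernel s, M.pairValue α V (s, u) = V s) (ν : ProbabilityMeasure S) :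
    M.meanReward ν φ + α * ∫ s, V s ∂(M.nextLaw ν φ : Measure S) = ∫ s, V s ∂(ν : Measure S) := by
  rw [meanReward_add_integral_nextLaw hR hV hC, ← integral_fst_joint hV ν φ]
  exact integral_congr_ae (Measure.ae_compProd_of_ae_ae
    (measurableSet_eq_fun (M.measurable_pairValue α hV) (hV.comp measurable_fst))
    (Filter.Eventually.of_forall hφ))

/-- Integration of a solution of the optimality equation solves the measurized equation. -/
lemma isMeasurizedSolution_integral {R : ℝ} (hR : ∀ p ∈ M.feasible, |M.reward p| ≤ R)
    {V : S → ℝ} (hV : Measurable V) {C : ℝ} (hC : ∀ s, |V s| ≤ C)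
    (hsup : ∀ p ∈ M.feasible, M.pairValue α V p ≤ V p.1) {φ : M.DecisionRule}
    (hφ : ∀ s, ∀ᵐ u ∂φ.kernel s, M.pairValue α V (s, u) = V s) :
    M.IsMeasurizedSolution α fun ν => ∫ s, V s ∂(ν : Measure S) := by
  refine ⟨measurable_integral_coe hV,
    ⟨C, fun ν => abs_integral_le_of_ae (Filter.Eventually.of_forall hC)⟩, fun ν => ?_⟩
  refine IsGreatest.isLUB ⟨⟨φ, meanReward_add_eq hR hV hC hφ ν⟩, ?_⟩
  rintro _ ⟨ψ, rfl⟩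
  exact meanReward_add_le hR hV hC hsup ν ψ

/-- An arbitrary solution comes with no maximizing rule, so verification is unavailable and
uniqueness is drawn from this contraction estimate. -/
lemma IsMeasurizedSolution.le_add (hα₀ : 0 ≤ α) {V W : ProbabilityMeasure S → ℝ}
    (hV : M.IsMeasurizedSolution α V) (hW : M.IsMeasurizedSolution α W) {D : ℝ}
    (hD : ∀ ν, V ν ≤ W ν + D) (ν : ProbabilityMeasure S) : V ν ≤ W ν + α * D := by
  refine (hV.2.2 ν).2 ?_
  rintro _ ⟨φ, rfl⟩
  have h1 := (hW.2.2 ν).1 ⟨φ, rfl⟩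
  have h2 := mul_le_mul_of_nonneg_left (hD (M.nextLaw ν φ)) hα₀
  simp only at h1
  linarith

/-- The measurized optimality equation has at most one bounded solution. -/
lemma IsMeasurizedSolution.unique (hα₀ : 0 ≤ α) (hα₁ : α < 1) {V W : ProbabilityMeasure S → ℝ}
    (hV : M.IsMeasurizedSolution α V) (hW : M.IsMeasurizedSolution α W) : V = W := by
  obtain ⟨C, hC⟩ := hV.2.1
  obtain ⟨C', hC'⟩ := hW.2.1
  refine eq_of_abs_sub_le_mul hα₀ hα₁ (C := C + C')
    (fun ν => (abs_sub _ _).trans (add_le_add (hC ν) (hC' ν))) fun D hD ν => ?_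
  have h1 := hV.le_add hα₀ hW (D := D) (fun ν => by linarith [(abs_le.1 (hD ν)).2]) ν
  have h2 := hW.le_add hα₀ hV (D := D) (fun ν => by linarith [(abs_le.1 (hD ν)).1]) ν
  rw [abs_le]
  constructor <;> linarith

/-- The supremum over deterministic sequences of decision rules. -/
lemma isLUB_tsum_lawPath (hα₀ : 0 ≤ α) (hα₁ : α < 1) {R : ℝ}
    (hR : ∀ p ∈ M.feasible, |M.reward p| ≤ R) {V : S → ℝ} (hV : Measurable V) {C : ℝ}
    (hC : ∀ s, |V s| ≤ C) (hsup : ∀ p ∈ M.feasible, M.pairValue α V p ≤ V p.1)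
    {φ : M.DecisionRule} (hφ : ∀ s, ∀ᵐ u ∂φ.kernel s, M.pairValue α V (s, u) = V s)
    (ν : ProbabilityMeasure S) :
    IsLUB (Set.range fun φ : ℕ → M.DecisionRule =>
      ∑' t, α ^ t * M.meanReward (M.lawPath ν φ t) (φ t)) (∫ s, V s ∂(ν : Measure S)) := by
  have hb : ∀ (ψ : ℕ → M.DecisionRule) t,
      |∫ s, V s ∂(M.lawPath ν ψ t : Measure S)| ≤ C := fun ψ t =>
    abs_integral_le_of_ae (Filter.Eventually.of_forall hC)
  refine IsGreatest.isLUB ⟨⟨fun _ => φ, ?_⟩, ?_⟩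
  · exact tsum_discounted_eq hα₀ hα₁ (fun t => abs_meanReward_le hR _ _) (hb fun _ => φ)
      fun t => meanReward_add_eq hR hV hC hφ _
  · rintro _ ⟨ψ, rfl⟩
    exact tsum_discounted_le hα₀ hα₁ (fun t => abs_meanReward_le hR _ _) (hb ψ)
      fun t => meanReward_add_le hR hV hC hsup _ _

/-- Needed for a rule of the original model to act as a deterministic decision rule of the
measurized one. -/
lemma measurable_joint (φ : M.DecisionRule) : Measurable fun ν => M.joint ν φ := by
  refine Measurable.subtype_mk ?_
  have h : (fun ν : ProbabilityMeasure S => (ν : Measure S) ⊗ₘ φ.kernel) =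
      fun ν : ProbabilityMeasure S => (ν : Measure S).bind (Kernel.id ×ₖ φ.kernel) := by
    funext ν
    exact Measure.compProd_eq_comp_prod _ _
  rw [h]
  exact (Measure.measurable_bind' (Kernel.measurable _)).comp measurable_subtype_coe

variable [StandardBorelSpace S] [StandardBorelSpace U]

/-- The measurized decision rule that applies the same decision rule in every state law. -/
noncomputable def DecisionRule.measurized (hΦ : Nonempty M.DecisionRule) (φ : M.DecisionRule) :
    (M.measurized hΦ).DecisionRule where
  kernel := Kernel.deterministic (fun ν => M.joint ν φ) (measurable_joint φ)
  isMarkovKernel := inferInstance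
  kernel_admissible ν := by
    rw [Kernel.deterministic_apply]
    exact Measure.dirac_apply_of_mem ⟨φ, rfl⟩

/-- The transition is a Dirac mass, so the continuation integral is a value of `W`; boundedness of
the reward lets the joint integral be iterated. -/
lemma pairValue_measurized_joint (hΦ : Nonempty M.DecisionRule) {R : ℝ}
    (hR : ∀ p ∈ M.feasible, |M.reward p| ≤ R) {W : ProbabilityMeasure S → ℝ} (hW : Measurable W)
    (ν : ProbabilityMeasure S) (φ : M.DecisionRule) :
    (M.measurized hΦ).pairValue α W (ν, M.joint ν φ) =
      M.meanReward ν φ + α * W (M.nextLaw ν φ) := by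
  rw [← integral_reward_joint hR]
  have h : ∫ μ, W μ ∂(M.measurized hΦ).transition (ν, M.joint ν φ) = W (M.nextLaw ν φ) := by
    change ∫ μ, W μ ∂Kernel.deterministic (fun p : ProbabilityMeasure S × _ => M.push p.2)
      (M.measurable_push.comp measurable_snd) (ν, M.joint ν φ) = _
    rw [Kernel.deterministic_apply, integral_dirac' _ _ hW.stronglyMeasurable]
    rfl
  unfold pairValue
  rw [h]
  rfl

/-- The optimal value function of the measurized model is the integral of a solution of the
optimality equation. -/
lemma optimalValue_measurized_eq (hΦ : Nonempty M.DecisionRule) (hα₀ : 0 ≤ α) (hα₁ : α < 1)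
    {R : ℝ} (hR : ∀ p ∈ M.feasible, |M.reward p| ≤ R) {V : S → ℝ} (hV : Measurable V) {C : ℝ}
    (hC : ∀ s, |V s| ≤ C) (hsup : ∀ p ∈ M.feasible, M.pairValue α V p ≤ V p.1)
    {φ : M.DecisionRule} (hφ : ∀ s, ∀ᵐ u ∂φ.kernel s, M.pairValue α V (s, u) = V s) :
    (M.measurized hΦ).optimalValue α = fun ν : ProbabilityMeasure S => ∫ s, V s ∂(ν : Measure S) := by
  have hW : Measurable fun ν : ProbabilityMeasure S => ∫ s, V s ∂(ν : Measure S) :=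
    measurable_integral_coe hV
  -- Verification in the measurized model, with `φ` used in every state law.
  refine optimalValue_eq hα₀ hα₁ (R := R) ?_ hW
    (C := C) (fun ν => abs_integral_le_of_ae (Filter.Eventually.of_forall hC)) ?_
    (φ.measurized hΦ) fun ν => ?_
  · rintro ⟨ν, γ⟩ ⟨ψ, hψ⟩
    obtain rfl : M.joint ν ψ = γ := hψ
    change |∫ p, M.reward p ∂(M.joint ν ψ : Measure (S × U))| ≤ R
    rw [integral_reward_joint hR]
    exact abs_meanReward_le hR ν ψ
  · rintro ⟨ν, γ⟩ ⟨ψ, hψ⟩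
    obtain rfl : M.joint ν ψ = γ := hψ
    rw [pairValue_measurized_joint hΦ hR hW]
    exact meanReward_add_le hR hV hC hsup ν ψ
  · change ∀ᵐ γ ∂Kernel.deterministic (fun ν => M.joint ν φ) (measurable_joint φ) ν, _
    rw [Kernel.deterministic_apply, ae_dirac_iff]
    · rw [pairValue_measurized_joint hΦ hR hW]
      exact meanReward_add_eq hR hV hC hφ ν
    · exact measurableSet_eq_fun
        (((M.measurized hΦ).measurable_pairValue α hW).comp measurable_prodMk_left)
        measurable_const

end Measurized

end MDM

theorem theorem5p1 {S U : Type*}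
    [TopologicalSpace S] [TopologicalSpace.MetrizableSpace S] [SecondCountableTopology S]
    [MeasurableSpace S] [BorelSpace S] [StandardBorelSpace S]
    [TopologicalSpace U] [TopologicalSpace.MetrizableSpace U] [SecondCountableTopology U]
    [MeasurableSpace U] [BorelSpace U] [StandardBorelSpace U]
    (M : MDM S U) (α : ℝ) (hα₀ : 0 ≤ α) (hα₁ : α < 1) (hM : M.Conditions α) :
    (M.IsOptimalitySolution α (M.optimalValue α) ∧
      ∀ V, M.IsOptimalitySolution α V → V = M.optimalValue α) ∧
    (M.IsMeasurizedSolution α ((M.measurized hM.nonempty_decisionRule).optimalValue α) ∧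
      ∀ W, M.IsMeasurizedSolution α W →
        W = (M.measurized hM.nonempty_decisionRule).optimalValue α) ∧
    (∀ ν : ProbabilityMeasure S,
      IsLUB (Set.range fun φ : ℕ → M.DecisionRule =>
          ∑' t, α ^ t * M.meanReward (M.lawPath ν φ t) (φ t))
        ((M.measurized hM.nonempty_decisionRule).optimalValue α ν)) ∧
    (∀ s : S, (M.measurized hM.nonempty_decisionRule).optimalValue α (diracProba s) =
      M.optimalValue α s) ∧
    (∀ ν : ProbabilityMeasure S, (M.measurized hM.nonempty_decisionRule).optimalValue α ν =
      ∫ s, M.optimalValue α s ∂(ν : Measure S)) := by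
  obtain ⟨V, hV⟩ := hM.exists_isOptimalitySolution hα₀ hα₁
  obtain ⟨R, hR⟩ := hM.exists_abs_reward_le
  obtain ⟨φ, hφ⟩ := hM.exists_optimal_decisionRule hV
  obtain ⟨C, hC⟩ := hV.2.1
  have hsup : ∀ p ∈ M.feasible, M.pairValue α V p ≤ V p.1 := fun p hp => hV.pairValue_le hp
  have hopt := hM.optimalValue_eq hα₀ hα₁ hV
  have hmopt := MDM.optimalValue_measurized_eq hM.nonempty_decisionRule hα₀ hα₁ hR hV.1 hC hsup hφ
  have hmsol := MDM.isMeasurizedSolution_integral hR hV.1 hC hsup hφ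
  rw [hmopt, hopt]
  refine ⟨⟨hV, fun V' hV' => ?_⟩, ⟨hmsol, fun W hW => hW.unique hα₀ hα₁ hmsol⟩,
    MDM.isLUB_tsum_lawPath hα₀ hα₁ hR hV.1 hC hsup hφ, fun s => ?_, fun ν => rfl⟩
  · rw [← hopt, hM.optimalValue_eq hα₀ hα₁ hV']
  · exact integral_dirac' _ _ hV.1.stronglyMeasurable
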